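/- Let $K$ be a field. A $K$-variety is an integral separated $K$-scheme of finite type, and a curve over $K$ is a one-dimensional $K$-variety. For a $K$-scheme $X$ we say that the extension conjecture holds for $X$ if for every smooth projective curve $C$ over $K$, every zero-dimensional closed subscheme $Z \subset C$ and every $K$-morphism $\phi : Z \to X$ there is a $K$-morphism $\Phi : C \to X$ such that $\Phi|_Z = \phi$. Proposition 4.5. Let $X$ and $X'$ be smooth projective $K$-varieties which are birational to each other over $K$. If the extension conjecture holds for $X$, then it also holds for $X'$. -/

import Mathlib

open CategoryTheory AlgebraicGeometry

universe u

noncomputable section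

attribute [local instance] MvPolynomial.gradedAlgebra

/-- Projective `n`-space over a field `K`: `Proj` of `K[x₀, …, xₙ]` with its standard grading. -/
def ProjectiveSpaceOver (K : Type u) [Field K] (n : ℕ) : Scheme.{u} :=
  Proj (MvPolynomial.homogeneousSubmodule (Fin (n + 1)) K)

/-- The structure morphism `ℙⁿ_K ⟶ Spec K`, induced by the inclusion of the constants `K` in the
degree `0` part of `K[x₀, …, xₙ]`. -/
def ProjectiveSpaceOver.structureMap (K : Type u) [Field K] (n : ℕ) :
    ProjectiveSpaceOver K n ⟶ Spec (CommRingCat.of K) :=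
  Proj.toSpecZero (MvPolynomial.homogeneousSubmodule (Fin (n + 1)) K) ≫
    Spec.map (CommRingCat.ofHom
      (algebraMap K (MvPolynomial.homogeneousSubmodule (Fin (n + 1)) K 0)))

/-- A `K`-scheme is projective if it admits a closed immersion over `K` into some `ℙⁿ_K`. -/
def IsProjectiveOver {K : Type u} [Field K] {X : Scheme.{u}}
    (sX : X ⟶ Spec (CommRingCat.of K)) : Prop :=
  ∃ (n : ℕ) (j : X ⟶ ProjectiveSpaceOver K n),
    IsClosedImmersion j ∧ j ≫ ProjectiveSpaceOver.structureMap K n = sX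

/-- Smooth projective `K`-varieties: integral `K`-schemes that are smooth and projective. -/
structure IsSmoothProjectiveVariety {K : Type u} [Field K] {X : Scheme.{u}}
    (sX : X ⟶ Spec (CommRingCat.of K)) : Prop where
  isIntegral : IsIntegral X
  smooth : Smooth sX
  projective : IsProjectiveOver sX

/-- Smooth projective curves over `K`: integral projective `K`-schemes that are smooth of relative
dimension one over `K`. -/
structure IsSmoothProjectiveCurve {K : Type u} [Field K] {C : Scheme.{u}}
    (sC : C ⟶ Spec (CommRingCat.of K)) : Prop where
  isIntegral : IsIntegral C
  smooth : SmoothOfRelativeDimension 1 sC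
  projective : IsProjectiveOver sC

/-- The statement of the extension conjecture for the `K`-scheme `X`: for every smooth projective
curve `C` over `K` and every zero-dimensional closed subscheme `i : Z ⟶ C`, every `K`-morphism
`φ : Z ⟶ X` is the restriction to `Z` of a `K`-morphism `Φ : C ⟶ X`. -/
def ExtensionConjectureHolds {K : Type u} [Field K] {X : Scheme.{u}}
    (sX : X ⟶ Spec (CommRingCat.of K)) : Prop :=
  ∀ (C : Scheme.{u}) (sC : C ⟶ Spec (CommRingCat.of K)), IsSmoothProjectiveCurve sC →
    ∀ (Z : Scheme.{u}) (i : Z ⟶ C), IsClosedImmersion i → topologicalKrullDim Z = 0 →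
      ∀ φ : Z ⟶ X, φ ≫ sX = i ≫ sC →
        ∃ Φ : C ⟶ X, Φ ≫ sX = sC ∧ i ≫ Φ = φ

end

/-!
The morphism `φ : Z ⟶ X'` is transported to a morphism from a larger zero-dimensional subscheme
`T` of the curve `C` to `X`, the hypothesis extends the latter to a morphism `Ψ : C ⟶ X`, and the
morphism `Φ : C ⟶ X'` birationally corresponding to `Ψ` extends `φ`. The difficulty is that `φ` may
map points of `Z` outside of the domain of the birational map, and then the subscheme `T` has to be
a sufficiently thick neighbourhood of `Z`.

If `Z` contains the generic point of `C`, then `Z` is equal to `C`. Otherwise `Z` is a finite set of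
closed points `z`, the local ring `R` of `C` at each of them is a discrete valuation ring with
maximal ideal `m`, and `Z` is given at `z` by a quotient `Q` of `R / m ^ n`. Smoothness of `X'`
provides a lift of `φ` at `z` to an arc of `X'` which is not contained in any given proper closed
subset: it suffices to lift the values of étale coordinates from `Q` to `R`, which can be done
outside of any given hypersurface. The arc is defined over a discrete valuation ring `S` that is
the localization of an étale `R`-algebra and maps to all the quotients `R / m ^ N`; no henselization
is needed (`exists_arc`). Since the generic point of the arc lies in the domain of the birational map
and `X` is proper, the arc is mapped to an arc of `X`, which is truncated modulo `m ^ N`. When `N` is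
large, every `R`-point of `X` with this truncation corresponds to an `R`-point of `X'` that agrees
with the given arc modulo `m ^ n`: the coordinate functions of `X'` are fractions of functions on
`X` whose denominators have a fixed order of vanishing along the arc (`exists_lift_of_congr`). The
result of this local study is `exists_approximation`.

The scheme `T` is the disjoint union of the `Spec (R / m ^ N)` over the points of `Z`
(`isClosedImmersion_sigmaDesc`). The generic point of `Ψ : C ⟶ X` corresponds to a point of `X'` in
the function field of `C`, which extends to a morphism `Φ : C ⟶ X'` as `X'` is proper and the local
rings of `C` are valuation rings (`exists_extension`). At the points of `Z` it coincides with
the `R`-points of `X'` found above, because `X'` is separated, and therefore it restricts to `φ`.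
-/

open IsLocalRing

attribute [local instance] MvPolynomial.gradedAlgebra

/-! ### Discrete valuation rings and étale algebras -/

lemma nontrivial_quotient_maximalIdeal_pow (R : Type*) [CommRing R] [IsLocalRing R] {N : ℕ}
    (hN : 0 < N) : Nontrivial (R ⧸ maximalIdeal R ^ N) :=
  Ideal.Quotient.nontrivial_iff.mpr fun h ↦ (maximalIdeal.isMaximal R).ne_top <|
    (Ideal.eq_top_iff_one _).mpr <| Ideal.pow_le_self hN.ne' ((Ideal.eq_top_iff_one _).mp h)

/-- A noetherian local ring whose maximal ideal is generated by a non-nilpotent element `t` is a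
discrete valuation ring: by Krull's intersection theorem every nonzero element is a unit times a
power of `t`. -/
lemma exists_isDomain_isDiscreteValuationRing {S : Type*} [CommRing S] [IsLocalRing S]
    [IsNoetherianRing S] {t : S} (ht : maximalIdeal S = Ideal.span {t}) (hnil : ¬ IsNilpotent t) :
    ∃ _ : IsDomain S, IsDiscreteValuationRing S := by
  have key : ∀ x : S, x ≠ 0 → ∃ (n : ℕ) (v : Sˣ), x = t ^ n * v := by
    intro x hx
    have hI : ⨅ i, maximalIdeal S ^ i = ⊥ :=
      Ideal.iInf_pow_eq_bot_of_isLocalRing _ (maximalIdeal.isMaximal S).ne_top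
    have hex : ∃ n, x ∉ maximalIdeal S ^ n := by
      by_contra! h
      have hmem : x ∈ ⨅ i, maximalIdeal S ^ i := (Submodule.mem_iInf _).mpr h
      rw [hI] at hmem
      exact hx hmem
    classical
    obtain ⟨n, hn⟩ : ∃ n, Nat.find hex = n + 1 := Nat.exists_eq_succ_of_ne_zero (by
      intro h0
      have := Nat.find_spec hex
      rw [h0] at this
      simp at this)
    have h1 : x ∈ maximalIdeal S ^ n := by
      by_contra h
      exact absurd (Nat.find_min' hex h) (by omega)
    have h2 : x ∉ maximalIdeal S ^ (n + 1) := hn ▸ Nat.find_spec hex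
    rw [ht, Ideal.span_singleton_pow, Ideal.mem_span_singleton] at h1 h2
    obtain ⟨y, rfl⟩ := h1
    have hy : IsUnit y := by
      by_contra hy
      have : y ∈ maximalIdeal S := hy
      rw [ht, Ideal.mem_span_singleton] at this
      obtain ⟨z, rfl⟩ := this
      exact h2 ⟨z, by ring⟩
    exact ⟨n, hy.unit, rfl⟩
  have hdom : IsDomain S := by
    have : NoZeroDivisors S := ⟨by
      intro a b hab
      by_contra! h
      obtain ⟨n, v, rfl⟩ := key a h.1
      obtain ⟨m, w, rfl⟩ := key b h.2
      refine hnil ⟨n + m, ?_⟩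
      have : t ^ (n + m) * ((v * w : Sˣ) : S) = 0 := by rw [← hab]; push_cast; ring
      exact (Units.mul_left_eq_zero _).mp this⟩
    exact NoZeroDivisors.to_isDomain S
  refine ⟨hdom, ?_⟩
  have ht0 : t ≠ 0 := fun h ↦ hnil (h ▸ IsNilpotent.zero)
  have hfield : ¬ IsField S := by
    rw [isField_iff_maximalIdeal_eq, ht, Ideal.span_singleton_eq_bot]
    exact ht0
  have hprin : (maximalIdeal S).IsPrincipal := ⟨t, ht⟩
  exact ((IsDiscreteValuationRing.TFAE S hfield).out 4 0).mp hprin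

/-- A noetherian local domain whose maximal ideal is principal is a valuation ring. -/
lemma ValuationRing.of_isPrincipal_maximalIdeal {S : Type*} [CommRing S] [IsDomain S]
    [IsLocalRing S] [IsNoetherianRing S] (h : (maximalIdeal S).IsPrincipal) :
    ValuationRing S := by
  by_cases hS : IsField S
  · let := hS.toField
    infer_instance
  · exact ((IsDiscreteValuationRing.TFAE S hS).out 4 1).mp h

/-- The local rings of a domain étale over a principal ideal domain have principal maximal
ideals. -/
lemma isPrincipal_maximalIdeal_of_etale (P : Type*) {A : Type*} [CommRing P] [IsDomain P]
    [IsPrincipalIdealRing P] [CommRing A] [Algebra P A] [Algebra.Etale P A]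
    (q : Ideal A) [q.IsPrime] :
    (maximalIdeal (Localization.AtPrime q)).IsPrincipal := by
  let p := q.under P
  let := Localization.AtPrime.algebraOfLiesOver p q
  have h : (maximalIdeal (Localization.AtPrime p)).map
      (algebraMap (Localization.AtPrime p) (Localization.AtPrime q)) =
        maximalIdeal (Localization.AtPrime q) := by
    have : Algebra.EssFiniteType (Localization.AtPrime p) (Localization.AtPrime q) :=
      .of_comp P _ _
    have : Algebra.FormallyUnramified (Localization.AtPrime p) (Localization.AtPrime q) :=
      .of_restrictScalars P _ _
    exact Algebra.FormallyUnramified.map_maximalIdeal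
  rw [← h, ← Localization.AtPrime.map_eq_maximalIdeal]
  infer_instance

/-- Over a domain `P`, every nonzero element of an étale `P`-algebra that is a domain divides the
image of a nonzero element of `P`: étale algebras are generically finite. -/
lemma exists_ne_zero_dvd_algebraMap_of_etale (P : Type*) {A : Type*} [CommRing P] [IsDomain P]
    [CommRing A] [IsDomain A] [Algebra P A] [Algebra.Etale P A] {g : A} (hg : g ≠ 0) :
    ∃ F : P, F ≠ 0 ∧ g ∣ algebraMap P A F := by
  by_cases hinj : Function.Injective (algebraMap P A)
  swap
  · obtain ⟨F, hF, hF0⟩ : ∃ F, algebraMap P A F = 0 ∧ F ≠ 0 := by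
      simpa only [injective_iff_map_eq_zero, not_forall, exists_prop] using hinj
    exact ⟨F, hF0, hF ▸ dvd_zero g⟩
  have : FaithfulSMul P A := (faithfulSMul_iff_algebraMap_injective P A).mpr hinj
  let k := FractionRing P
  let T := TensorProduct P k A
  have hfin : Module.Finite k T := Algebra.FormallyUnramified.finite_of_free k T
  let j : A →ₐ[P] T := Algebra.TensorProduct.includeRight
  have hj : Function.Injective j :=
    Algebra.TensorProduct.includeRight_injective (IsFractionRing.injective P k)
  have halg : IsAlgebraic k (j g) := IsAlgebraic.of_finite k _
  have halg' : IsAlgebraic P (j g) := (IsFractionRing.isAlgebraic_iff P k T).mpr halg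
  have : IsAlgebraic P g := (isAlgebraic_algHom_iff j hj).mp halg'
  obtain ⟨F, hF, h⟩ := this.exists_nonzero_dvd (mem_nonZeroDivisors_of_ne_zero hg)
  exact ⟨F, hF, h⟩

/-- A nonzero polynomial over a field `K` takes a nonzero value at some point of `R ^ d` that lies
in a prescribed residue class modulo `t`, for `R` an infinite domain over `K` and `t ≠ 0`. -/
lemma exists_aeval_ne_zero {K R : Type*} [Field K] [CommRing R] [IsDomain R] [Infinite R]
    [Algebra K R] {d : ℕ} {F : MvPolynomial (Fin d) K} (hF : F ≠ 0) {t : R} (ht : t ≠ 0)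
    (y : Fin d → R) : ∃ y' : Fin d → R, (∀ i, t ∣ y' i - y i) ∧ MvPolynomial.aeval y' F ≠ 0 := by
  by_contra! h
  have h0 : MvPolynomial.map (algebraMap K R) F = 0 := by
    refine MvPolynomial.funext_set (fun i ↦ Set.range fun r ↦ y i + t * r) (fun i ↦ ?_) ?_
    · refine Set.infinite_range_of_injective fun a b hab ↦ ?_
      exact mul_left_cancel₀ ht (add_left_cancel hab)
    · intro x hx
      have := h x fun i ↦ by
        obtain ⟨r, hr⟩ := hx i trivial
        exact ⟨r, by rw [← hr]; ring⟩
      rw [MvPolynomial.eval_map, map_zero, ← this, MvPolynomial.aeval_def]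
  exact hF (MvPolynomial.map_injective _ (algebraMap K R).injective (by rw [h0, map_zero]))

/-! ### Lifting infinitesimal arcs -/

set_option maxHeartbeats 1000000 in
/-- Lifting of infinitesimal arcs. Let `A` be étale over a polynomial ring over `K`, let `R` be a
discrete valuation ring over `K` with maximal ideal `m`, and let `f : A → Q` be a point of `A` in
a quotient `Q` of `R / m ^ n`. Given `g ≠ 0` in `A`, there are a discrete valuation ring `S`,
unramified over `R` and mapping to all the `R / m ^ N`, and an `S`-point `α` of `A` that
induces `f` and does not factor through the locus `g = 0`.

Lifts of `f` to `S`-points correspond to lifts of the étale coordinates, and these can be chosen in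
`R` away from a hypersurface containing the image of `g = 0`. The ring `S` is a localization of the
resulting base change of `A` to `R`. -/
lemma exists_arc {K A R Q : Type u} [Field K] [CommRing A] [IsDomain A] [Algebra K A] [CommRing R]
    [IsDomain R] [IsDiscreteValuationRing R] [Algebra K R] [CommRing Q] [IsLocalRing Q]
    [Algebra R Q] [Algebra K Q] [IsScalarTower K R Q] {d : ℕ}
    (φ : MvPolynomial (Fin d) K →ₐ[K] A) (hφ : φ.toRingHom.Etale) {g : A} (hg : g ≠ 0)
    (hq : Function.Surjective (algebraMap R Q)) {n : ℕ}
    (hn : maximalIdeal R ^ n ≤ RingHom.ker (algebraMap R Q)) (f : A →ₐ[K] Q) :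
    ∃ (S : Type u) (_ : CommRing S) (_ : IsDomain S) (_ : IsDiscreteValuationRing S)
      (_ : Algebra R S) (_ : Algebra K S) (_ : IsScalarTower K R S),
      (maximalIdeal R).map (algebraMap R S) = maximalIdeal S ∧
      ∃ α : A →ₐ[K] S, α g ≠ 0 ∧ ∀ N ≥ n, ∃ ρ : S →ₐ[R] R ⧸ maximalIdeal R ^ N,
        ∀ a r, Ideal.Quotient.mk _ r = ρ (α a) → algebraMap R Q r = f a := by
  obtain ⟨t, ht⟩ := IsDiscreteValuationRing.exists_irreducible R
  have htm : maximalIdeal R = Ideal.span {t} := ht.maximalIdeal_eq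
  have : Infinite R := by
    by_contra h
    rw [not_infinite_iff_finite] at h
    exact IsDiscreteValuationRing.not_isField R (Finite.isField_of_domain R)
  let P := MvPolynomial (Fin d) K
  let := φ.toRingHom.toAlgebra
  have : Algebra.Etale P A := hφ
  have : IsScalarTower K P A := .of_algebraMap_eq fun x ↦ (φ.commutes x).symm
  obtain ⟨F, hF0, hgF⟩ := exists_ne_zero_dvd_algebraMap_of_etale P hg
  -- `y₀` lifts the coordinates of `f`; `y` is congruent to it modulo `m ^ n` and avoids `F = 0`
  choose y₀ hy₀ using fun i ↦ hq (f (φ (MvPolynomial.X i)))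
  obtain ⟨y, hy, hyF⟩ := exists_aeval_ne_zero hF0 (pow_ne_zero n ht.ne_zero) y₀
  have hyq : ∀ i, algebraMap R Q (y i) = f (φ (MvPolynomial.X i)) := by
    intro i
    rw [← hy₀, ← sub_eq_zero, ← map_sub]
    refine hn ?_
    rw [htm, Ideal.span_singleton_pow, Ideal.mem_span_singleton]
    exact hy i
  let ev : P →ₐ[K] R := MvPolynomial.aeval y
  let := ev.toRingHom.toAlgebra
  have : IsScalarTower K P R := .of_algebraMap_eq fun x ↦ (ev.commutes x).symm
  let := ((algebraMap R Q).comp ev.toRingHom).toAlgebra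
  have : IsScalarTower P R Q := .of_algebraMap_eq fun x ↦ rfl
  have hfφ : ∀ p : P, f (algebraMap P A p) = algebraMap P Q p := by
    intro p
    have : f.comp φ = (IsScalarTower.toAlgHom K R Q).comp ev := by
      ext i
      simp [ev, hyq]
    exact DFunLike.congr_fun this p
  let f' : A →ₐ[P] Q := { f with commutes' := hfφ }
  let B := TensorProduct P R A
  let fB : B →ₐ[R] Q := Algebra.TensorProduct.lift (Algebra.ofId R Q) f' fun _ _ ↦ .all _ _
  let 𝔮 : Ideal B := (maximalIdeal Q).comap fB
  have h𝔮 : 𝔮.IsPrime := Ideal.comap_isPrime _ _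
  let S := Localization.AtPrime 𝔮
  have hunit : ∀ s : 𝔮.primeCompl, IsUnit (fB s) := fun s ↦ by
    by_contra h
    exact s.2 h
  let fS : S →ₐ[R] Q := IsLocalization.liftAlgHom (M := 𝔮.primeCompl) (f := fB) hunit
  have hfS : ∀ b : B, fS (algebraMap B S b) = fB b := fun b ↦
    IsLocalization.lift_eq (M := 𝔮.primeCompl) (g := (fB : B →+* Q)) hunit b
  have : IsNoetherianRing B := Algebra.FiniteType.isNoetherianRing R B
  have : IsNoetherianRing S := IsLocalization.isNoetherianRing 𝔮.primeCompl S inferInstance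
  have hloc : IsLocalHom (algebraMap R S) := by
    constructor
    intro r hr
    have h1 : IsUnit (algebraMap R Q r) := by
      have := hr.map fS
      rwa [fS.commutes] at this
    have : IsLocalHom (algebraMap R Q) := hq.isLocalHom
    exact h1.of_map
  have hmax : (maximalIdeal R).map (algebraMap R S) = maximalIdeal S :=
    Algebra.FormallyUnramified.map_maximalIdeal
  -- `S` is formally étale over `R` and the kernel of `R / m ^ N → Q` is nilpotent
  have hlift : ∀ N ≥ n, ∃ ρ : S →ₐ[R] R ⧸ maximalIdeal R ^ N,
      ∀ s r, Ideal.Quotient.mk _ r = ρ s → algebraMap R Q r = fS s := by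
    intro N hN
    let π : R ⧸ maximalIdeal R ^ N →ₐ[R] Q := Ideal.Quotient.liftₐ _ (Algebra.ofId R Q)
      fun a ha ↦ hn (Ideal.pow_le_pow_right hN ha)
    have hπ : Function.Surjective π := fun z ↦ by
      obtain ⟨r, rfl⟩ := hq z
      exact ⟨Ideal.Quotient.mk _ r, rfl⟩
    have hnil : IsNilpotent (RingHom.ker π) := by
      refine ⟨N, ?_⟩
      rw [Ideal.zero_eq_bot, eq_bot_iff]
      have hker : RingHom.ker π ≤ (maximalIdeal R).map (Ideal.Quotient.mk (maximalIdeal R ^ N)) := by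
        intro x hx
        obtain ⟨r, rfl⟩ := Ideal.Quotient.mk_surjective x
        refine Ideal.mem_map_of_mem _ ?_
        by_contra hr
        have h1 : IsUnit r := by simpa using hr
        have h2 : algebraMap R Q r = 0 := hx
        exact (h1.map (algebraMap R Q)).ne_zero h2
      refine (Ideal.pow_right_mono hker N).trans ?_
      rw [← Ideal.map_pow, Ideal.map_quotient_self]
    refine ⟨Algebra.FormallySmooth.liftOfSurjective fS π hπ hnil, fun s r hr ↦ ?_⟩
    rw [← Algebra.FormallySmooth.liftOfSurjective_apply fS π hπ hnil s, ← hr]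
    rfl
  -- `S` maps to `R / m ^ N` for every `N ≥ n`, so no power of `t` vanishes in `S`
  have hnil : ¬ IsNilpotent (algebraMap R S t) := by
    rintro ⟨k, hk⟩
    obtain ⟨ρ, -⟩ := hlift (max n (k + 1)) (le_max_left _ _)
    have h1 : ρ (algebraMap R S t ^ k) = 0 := by rw [hk, map_zero]
    rw [map_pow, ρ.commutes, ← map_pow] at h1
    have h2 : t ^ k ∈ maximalIdeal R ^ (max n (k + 1)) := Ideal.Quotient.eq_zero_iff_mem.mp h1
    rw [htm, Ideal.span_singleton_pow, Ideal.mem_span_singleton,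
      pow_dvd_pow_iff ht.ne_zero ht.not_isUnit] at h2
    have := le_max_right n (k + 1)
    omega
  obtain ⟨_, hdvr⟩ := exists_isDomain_isDiscreteValuationRing (S := S)
    (t := algebraMap R S t) (by rw [← hmax, htm, Ideal.map_span, Set.image_singleton]) hnil
  have : FaithfulSMul R S := by
    rw [faithfulSMul_iff_algebraMap_injective, injective_iff_map_eq_zero]
    intro r hr
    by_contra hr0
    obtain ⟨k, v, rfl⟩ := IsDiscreteValuationRing.eq_unit_mul_pow_irreducible hr0 ht
    rw [map_mul, map_pow] at hr
    exact hnil ⟨k, ((v.isUnit.map (algebraMap R S)).mul_right_eq_zero).mp hr⟩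
  let α₀ : A →ₐ[P] B := Algebra.TensorProduct.includeRight
  let α : A →ₐ[P] S := (IsScalarTower.toAlgHom P B S).comp α₀
  have hKS : IsScalarTower K P S := inferInstance
  have hKRS : IsScalarTower K R S := inferInstance
  refine ⟨S, inferInstance, inferInstance, hdvr, inferInstance, inferInstance, inferInstance,
    hmax, α.restrictScalars K, ?_, fun N hN ↦ ?_⟩
  · intro h0
    obtain ⟨e, he⟩ := hgF
    have h1 : α (algebraMap P A F) = 0 := by
      rw [he, map_mul]
      exact mul_eq_zero_of_left h0 _
    rw [α.commutes, IsScalarTower.algebraMap_apply P R S] at h1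
    exact hyF ((map_eq_zero_iff _ (FaithfulSMul.algebraMap_injective R S)).mp h1)
  · obtain ⟨ρ, hρ⟩ := hlift N hN
    refine ⟨ρ, fun a r h ↦ ?_⟩
    rw [hρ _ _ h]
    change fS (algebraMap B S (α₀ a)) = f a
    rw [hfS]
    have h1 : fB (α₀ a) = algebraMap R Q 1 * f' a := Algebra.TensorProduct.lift_tmul ..
    rw [h1, map_one, one_mul]
    rfl

/-! ### Rational maps and congruent arcs -/

/-- A rational map from `Spec B` to `Spec A`, given by `θ : A → B[1/b]`, maps every `R`-point `ψ`
of `B` that is close to an arc `β` along which `θ` extends to an arc `α` of `A`, to an `R`-point `h`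
of `A` that is close to `α`.

Here "close" means congruent modulo a high power of the maximal ideal `m` of the discrete valuation
ring `R`; the precision that is lost is the order of vanishing along `β` of a common denominator of
the values of `θ` on generators of `A`. That `θ` maps `β` to `α`, and `ψ` to `h`, is expressed by
clearing denominators. -/
lemma exists_lift_of_congr {K R S A B Bb : Type*} [Field K] [CommRing R] [IsDomain R]
    [IsDiscreteValuationRing R] [Algebra K R] [CommRing S] [IsDomain S] [IsDiscreteValuationRing S]
    [Algebra K S] [Algebra R S] [IsScalarTower K R S]
    (hRS : (maximalIdeal R).map (algebraMap R S) = maximalIdeal S)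
    [CommRing A] [Algebra K A] [Algebra.FiniteType K A] [CommRing B] [Algebra K B]
    [CommRing Bb] [Algebra B Bb] [Algebra K Bb] [IsScalarTower K B Bb] (b : B)
    [IsLocalization.Away b Bb] (θ : A →ₐ[K] Bb) (α : A →ₐ[K] S) (β : B →ₐ[K] S) (hb : β b ≠ 0)
    (hθ : ∀ a k x, θ a * algebraMap B Bb (b ^ k) = algebraMap B Bb x → α a * β (b ^ k) = β x) :
    ∃ e : ℕ, ∀ N > e, ∀ ρ : S →ₐ[R] R ⧸ maximalIdeal R ^ N, ∀ ψ : B →ₐ[K] R,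
      (∀ x, Ideal.Quotient.mk _ (ψ x) = ρ (β x)) →
        ψ b ≠ 0 ∧ ∃ h : A →ₐ[K] R,
          (∀ a k x, θ a * algebraMap B Bb (b ^ k) = algebraMap B Bb x → h a * ψ (b ^ k) = ψ x) ∧
          ∀ a r, Ideal.Quotient.mk _ r = ρ (α a) → h a - r ∈ maximalIdeal R ^ (N - e) := by
  classical
  obtain ⟨t, ht⟩ := IsDiscreteValuationRing.exists_irreducible R
  have htm : maximalIdeal R = Ideal.span {t} := ht.maximalIdeal_eq
  have hτ : Irreducible (algebraMap R S t) := by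
    rw [IsDiscreteValuationRing.irreducible_iff_uniformizer, ← hRS, htm, Ideal.map_span,
      Set.image_singleton]
  obtain ⟨s, hs⟩ := (inferInstance : Algebra.FiniteType K A).out
  -- a common denominator `b ^ k` for the values of `θ` on the generators
  obtain ⟨k, hk, hnum⟩ : ∃ k, 0 < k ∧
      ∀ a ∈ s, ∃ x, θ a * algebraMap B Bb (b ^ k) = algebraMap B Bb x := by
    obtain ⟨⟨_, k, rfl⟩, hc⟩ := IsLocalization.exist_integer_multiples_of_finset
      (Submonoid.powers b) (s.image θ)
    refine ⟨k + 1, k.succ_pos, fun a ha ↦ ?_⟩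
    obtain ⟨x, hx⟩ := hc _ (Finset.mem_image_of_mem θ ha)
    have hx' : algebraMap B Bb x = algebraMap B Bb (b ^ k) * θ a := by
      rw [hx, ← Algebra.smul_def]
    exact ⟨x * b, by rw [map_mul, hx', pow_succ, map_mul]; ring⟩
  choose! num hnum using hnum
  obtain ⟨e, v, hv⟩ := IsDiscreteValuationRing.eq_unit_mul_pow_irreducible
    (show β (b ^ k) ≠ 0 by rw [map_pow]; exact pow_ne_zero _ hb) hτ
  refine ⟨e, fun N hN ρ ψ hψ ↦ ?_⟩
  have hmem : ∀ {j : ℕ} {r : R}, r ∈ maximalIdeal R ^ j ↔ t ^ j ∣ r := by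
    intro j r
    rw [htm, Ideal.span_singleton_pow, Ideal.mem_span_singleton]
  have hpow : t ^ N = t ^ e * t ^ (N - e) := by rw [← pow_add]; congr 1; omega
  obtain ⟨w, hw⟩ := Ideal.Quotient.mk_surjective (ρ v)
  have hwu : IsUnit w := by
    have h1 : IsUnit (Ideal.Quotient.mk (maximalIdeal R ^ N) w) := hw ▸ v.isUnit.map ρ
    by_contra hw'
    have h2 : w ∈ maximalIdeal R := hw'
    have h3 : IsNilpotent (Ideal.Quotient.mk (maximalIdeal R ^ N) w) := by
      refine ⟨N, ?_⟩
      rw [← map_pow]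
      exact Ideal.Quotient.eq_zero_iff_mem.mpr (Ideal.pow_mem_pow h2 N)
    have := nontrivial_quotient_maximalIdeal_pow R (N := N) (by omega)
    exact h3.not_isUnit h1
  obtain ⟨z, hz⟩ : ∃ z, ψ (b ^ k) = w * t ^ e + t ^ N * z := by
    have h1 : Ideal.Quotient.mk (maximalIdeal R ^ N) (ψ (b ^ k)) =
        Ideal.Quotient.mk _ (w * t ^ e) := by
      rw [hψ, hv, map_mul, map_mul, ← hw, map_pow, map_pow, ρ.commutes]
      rfl
    obtain ⟨z, hz⟩ := hmem.mp (Ideal.Quotient.eq.mp h1)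
    exact ⟨z, by rw [← hz]; ring⟩
  have hvu : IsUnit (w + t ^ (N - e) * z) := by
    by_contra h
    have h1 : w + t ^ (N - e) * z ∈ maximalIdeal R := h
    have h2 : t ^ (N - e) * z ∈ maximalIdeal R :=
      Ideal.mul_mem_right _ _ (Ideal.pow_mem_of_mem _
        (by rw [htm]; exact Ideal.mem_span_singleton_self t) _ (by omega))
    have h3 : w ∈ maximalIdeal R := by simpa using Ideal.sub_mem _ h1 h2
    exact h3 hwu
  obtain ⟨u, hu⟩ := hvu
  have hψk : ψ (b ^ k) = t ^ e * u := by rw [hz, hu, hpow]; ring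
  have hψ0 : ψ (b ^ k) ≠ 0 := by
    rw [hψk]
    exact mul_ne_zero (pow_ne_zero _ ht.ne_zero) u.ne_zero
  have hψb : ψ b ≠ 0 := by
    intro h0
    exact hψ0 (by rw [map_pow, h0, zero_pow hk.ne'])
  -- along `ψ` the denominator divides the numerators, because it does so along `β` and both `ψ` and
  -- `β` are congruent modulo `m ^ N`, where `N` exceeds the order `e` of the denominator
  have hgen : ∀ a ∈ s, ∃ y, ψ (num a) = ψ (b ^ k) * y := by
    intro a ha
    obtain ⟨z', hz'⟩ := Ideal.Quotient.mk_surjective (ρ (α a))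
    have h1 : Ideal.Quotient.mk (maximalIdeal R ^ N) (ψ (num a)) =
        Ideal.Quotient.mk _ (z' * ψ (b ^ k)) := by
      rw [hψ, ← hθ _ _ _ (hnum a ha), map_mul, map_mul, ← hψ, hz']
    obtain ⟨y, hy⟩ := hmem.mp (Ideal.Quotient.eq.mp h1)
    refine ⟨z' + (u⁻¹ : Rˣ) * (t ^ (N - e) * y), ?_⟩
    rw [← sub_eq_zero, mul_add, mul_comm _ z', ← sub_sub, hy, hψk, hpow]
    linear_combination (-t ^ e * t ^ (N - e) * y) * u.mul_inv
  let F := FractionRing R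
  have hinj : Function.Injective (algebraMap R F) := IsFractionRing.injective R F
  let ψF : B →ₐ[K] F := (IsScalarTower.toAlgHom K R F).comp ψ
  have hψF : ∀ x, ψF x = algebraMap R F (ψ x) := fun _ ↦ rfl
  have hunit : ∀ x : Submonoid.powers b, IsUnit (ψF x) := by
    rintro ⟨_, j, rfl⟩
    rw [hψF, map_pow, map_pow]
    exact (IsUnit.mk0 _ ((map_ne_zero_iff _ hinj).mpr hψb)).pow j
  let ψb : Bb →ₐ[K] F := IsLocalization.liftAlgHom (M := Submonoid.powers b) (f := ψF) hunit
  have hψb' : ∀ x, ψb (algebraMap B Bb x) = algebraMap R F (ψ x) := fun x ↦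
    IsLocalization.lift_eq (M := Submonoid.powers b) (g := (ψF : B →+* F)) hunit x
  have hrange : ∀ a, ψb (θ a) ∈ (IsScalarTower.toAlgHom K R F).range := by
    suffices h : ⊤ ≤ (IsScalarTower.toAlgHom K R F).range.comap (ψb.comp θ) from
      fun a ↦ h (Algebra.mem_top (x := a))
    rw [← hs, Algebra.adjoin_le_iff]
    intro a ha
    obtain ⟨y, hy⟩ := hgen a ha
    refine ⟨y, ?_⟩
    have h1 := congrArg ψb (hnum a ha)
    rw [map_mul, hψb', hψb', hy, map_mul, mul_comm] at h1
    exact (mul_left_cancel₀ ((map_ne_zero_iff _ hinj).mpr hψ0) h1).symm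
  let h : A →ₐ[K] R := ((AlgEquiv.ofInjective (IsScalarTower.toAlgHom K R F) hinj).symm :
    _ →ₐ[K] R).comp ((ψb.comp θ).codRestrict _ hrange)
  have hh : ∀ a, algebraMap R F (h a) = ψb (θ a) := fun a ↦ congrArg Subtype.val
    ((AlgEquiv.ofInjective (IsScalarTower.toAlgHom K R F) hinj).apply_symm_apply
      ((ψb.comp θ).codRestrict _ hrange a))
  have hcompat : ∀ a k x, θ a * algebraMap B Bb (b ^ k) = algebraMap B Bb x →
      h a * ψ (b ^ k) = ψ x := by
    intro a k x hx
    apply hinj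
    rw [map_mul, hh, ← hψb', ← hψb', ← map_mul, hx]
  refine ⟨hψb, h, hcompat, ?_⟩
  let π : R ⧸ maximalIdeal R ^ N →ₐ[K] R ⧸ maximalIdeal R ^ (N - e) :=
    Ideal.Quotient.factorₐ K (Ideal.pow_le_pow_right (by omega))
  have hπ : ∀ r, π (Ideal.Quotient.mk _ r) = Ideal.Quotient.mk _ r := fun _ ↦ rfl
  -- dividing a congruence modulo `t ^ N` by the denominator loses `e` powers of `t`
  have heq : (Ideal.Quotient.mkₐ K (maximalIdeal R ^ (N - e))).comp h =
      π.comp ((ρ.restrictScalars K).comp α) := by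
    refine AlgHom.ext_of_adjoin_eq_top hs fun a ha ↦ ?_
    obtain ⟨z', hz'⟩ := Ideal.Quotient.mk_surjective (ρ (α a))
    change Ideal.Quotient.mk _ (h a) = π (ρ (α a))
    rw [← hz', hπ, Ideal.Quotient.eq, hmem]
    have h1 : Ideal.Quotient.mk (maximalIdeal R ^ N) (h a * ψ (b ^ k)) =
        Ideal.Quotient.mk _ (z' * ψ (b ^ k)) := by
      rw [hcompat _ _ _ (hnum a ha), hψ, ← hθ _ _ _ (hnum a ha), map_mul, map_mul, ← hψ, hz']
    have h2 := hmem.mp (Ideal.Quotient.eq.mp h1)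
    rw [← sub_mul, hψk, hpow, mul_left_comm (h a - z'),
      mul_dvd_mul_iff_left (pow_ne_zero _ ht.ne_zero), u.isUnit.dvd_mul_right] at h2
    exact h2
  intro a r hr
  have h1 : Ideal.Quotient.mk _ (h a) = π (ρ (α a)) := DFunLike.congr_fun heq a
  rw [← hr, hπ] at h1
  exact Ideal.Quotient.eq.mp h1

/-! ### Affine charts and étale coordinates -/

/-- A morphism from an affine scheme that lands in an affine open `V` is given by a ring map out of
the coordinate ring of `V`. -/
lemma AlgebraicGeometry.IsAffineOpen.exists_SpecMap_fromSpec_eq {X : Scheme.{u}} {V : X.Opens}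
    (hV : IsAffineOpen V) {R : CommRingCat.{u}} (f : Spec R ⟶ X) (hf : Set.range f ⊆ V) :
    ∃ φ : Γ(X, V) ⟶ R, Spec.map φ ≫ hV.fromSpec = f := by
  have h : Set.range f ⊆ Set.range hV.fromSpec := by rwa [hV.range_fromSpec]
  refine ⟨Spec.preimage (IsOpenImmersion.lift hV.fromSpec f h), ?_⟩
  rw [Spec.map_preimage, IsOpenImmersion.lift_fac]

/-- A morphism from a local scheme lands in every open neighbourhood of the image of the closed
point. -/
lemma AlgebraicGeometry.range_subset_of_closedPoint_mem {X : Scheme.{u}} {R : CommRingCat.{u}}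
    [IsLocalRing R] (f : Spec R ⟶ X) {V : X.Opens} (h : f (closedPoint R) ∈ V) :
    Set.range f ⊆ V := by
  rintro _ ⟨x, rfl⟩
  exact ((IsLocalRing.specializes_closedPoint x).map f.continuous).mem_open V.2 h

/-- Étale coordinates: a standard smooth chart of relative dimension `d` of a scheme over a field is
étale over a polynomial ring in `d` variables over the field. -/
lemma AlgebraicGeometry.IsAffineOpen.exists_etale_mvPolynomial {K : Type u} [Field K]
    {X : Scheme.{u}} (sX : X ⟶ Spec (CommRingCat.of K)) {d : ℕ}
    {U : (Spec (CommRingCat.of K)).Opens} (hU : IsAffineOpen U) {V : X.Opens} (hV : IsAffineOpen V)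
    {x : X} (hx : x ∈ V) (e : V ≤ sX ⁻¹ᵁ U)
    (h : (sX.appLE U V e).hom.IsStandardSmoothOfRelativeDimension d) :
    ∃ φ : MvPolynomial (Fin d) K →+* Γ(X, V), φ.Etale ∧
      Spec.map (CommRingCat.ofHom (φ.comp MvPolynomial.C)) = hV.fromSpec ≫ sX := by
  obtain rfl : U = ⊤ := by
    have : Subsingleton (Spec (CommRingCat.of K)) :=
      inferInstanceAs (Subsingleton (PrimeSpectrum K))
    ext y
    simpa using (Subsingleton.elim (sX x) y ▸ e hx : y ∈ U)
  let i : CommRingCat.of K ⟶ Γ(Spec (CommRingCat.of K), ⊤) := (Scheme.ΓSpecIso (.of K)).inv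
  have h' : (sX.appLE ⊤ V e).hom.comp i.hom |>.IsStandardSmoothOfRelativeDimension d :=
    RingHom.isStandardSmoothOfRelativeDimension_respectsIso.2 (sX.appLE ⊤ V e).hom
      (Scheme.ΓSpecIso (.of K)).symm.commRingCatIsoToRingEquiv h
  obtain ⟨φ, hφ, hφ'⟩ := h'.exists_etale_mvPolynomial
  refine ⟨φ, hφ', ?_⟩
  rw [hφ]
  change Spec.map (i ≫ sX.appLE ⊤ V e) = _
  rw [Spec.map_comp, ← IsAffineOpen.SpecMap_appLE_fromSpec sX (isAffineOpen_top _) hV e]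
  congr 1
  simp [i, IsAffineOpen.fromSpec_top]

/-- A smooth scheme over a field is covered by affine opens with étale coordinates. -/
lemma AlgebraicGeometry.Smooth.exists_etale_mvPolynomial {K : Type u} [Field K] {X : Scheme.{u}}
    (sX : X ⟶ Spec (CommRingCat.of K)) [Smooth sX] (x : X) :
    ∃ (V : X.Opens) (hV : IsAffineOpen V) (d : ℕ) (φ : MvPolynomial (Fin d) K →+* Γ(X, V)),
      x ∈ V ∧ φ.Etale ∧
        Spec.map (CommRingCat.ofHom (φ.comp MvPolynomial.C)) = hV.fromSpec ≫ sX := by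
  obtain ⟨U, hU, V, hV, hx, e, h⟩ := (Smooth.iff_forall_exists_isStandardSmooth sX).mp ‹_› x
  obtain ⟨_, _, _, _, ⟨P⟩⟩ := h
  algebraize [(sX.appLE U V e).hom]
  obtain ⟨φ, h1, h2⟩ := IsAffineOpen.exists_etale_mvPolynomial sX hU hV hx e
    (d := P.dimension) ⟨_, _, _, ‹_›, P, rfl⟩
  exact ⟨V, hV, _, φ, hx, h1, h2⟩

/-! ### Arcs under birational maps -/

/-- The existence part of the valuative criterion for proper morphisms. -/
lemma AlgebraicGeometry.IsProper.exists_lift {X S : Scheme.{u}} (s : X ⟶ S) [IsProper s]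
    {R : CommRingCat.{u}} [IsDomain R] [ValuationRing R] {F : Type u} [Field F] [Algebra R F]
    [IsFractionRing R F] (i₁ : Spec (CommRingCat.of F) ⟶ X) (i₂ : Spec R ⟶ S)
    (w : i₁ ≫ s = Spec.map (CommRingCat.ofHom (algebraMap R F)) ≫ i₂) :
    ∃ l : Spec R ⟶ X, Spec.map (CommRingCat.ofHom (algebraMap R F)) ≫ l = i₁ ∧ l ≫ s = i₂ := by
  have h : ValuativeCriterion.Existence s := by
    have : UniversallyClosed s := inferInstance
    rw [UniversallyClosed.eq_valuativeCriterion] at this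
    exact this.1
  obtain ⟨⟨l⟩⟩ := h ⟨R, F, i₁, i₂, ⟨w⟩⟩
  exact ⟨l.l, l.fac_left, l.fac_right⟩

lemma exists_hom_of_isLocalizationAway {B Bb : CommRingCat.{u}} [Algebra B Bb] (b : B)
    [IsLocalization.Away b Bb] {T FT : Type u} [CommRing T] [Field FT] [Algebra T FT]
    [FaithfulSMul T FT] (β : B ⟶ CommRingCat.of T) (hb : β.hom b ≠ 0) :
    ∃ l : Bb ⟶ CommRingCat.of FT, CommRingCat.ofHom (algebraMap B Bb) ≫ l =
      β ≫ CommRingCat.ofHom (algebraMap T FT) := by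
  have hu : IsUnit (((algebraMap T FT).comp β.hom) b) := by
    refine IsUnit.mk0 _ ?_
    rw [RingHom.comp_apply]
    exact (map_ne_zero_iff _ (FaithfulSMul.algebraMap_injective T FT)).mpr hb
  refine ⟨CommRingCat.ofHom (IsLocalization.Away.lift b hu), ?_⟩
  ext x
  exact IsLocalization.Away.lift_eq b hu x

lemma AlgebraicGeometry.IsAffineOpen.range_comp_fromSpec_subset_basicOpen {X : Scheme.{u}}
    {V : X.Opens} (hV : IsAffineOpen V) (a : Γ(X, V)) {FT : Type u} [Field FT]
    (φ : Γ(X, V) ⟶ CommRingCat.of FT) (ha : φ.hom a ≠ 0) :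
    Set.range (Spec.map φ ≫ hV.fromSpec) ⊆ X.basicOpen a := by
  rintro _ ⟨x, rfl⟩
  rw [Scheme.Hom.comp_apply]
  change (Spec.map φ) x ∈ hV.fromSpec ⁻¹ᵁ X.basicOpen a
  rw [hV.fromSpec_preimage_basicOpen]
  change φ.hom a ∉ x.asIdeal
  have : x.asIdeal = ⊥ := (Ideal.eq_bot_or_top x.asIdeal).resolve_right x.2.ne_top
  simpa [this] using ha

lemma AlgebraicGeometry.IsAffineOpen.map_ne_zero_of_range_subset_basicOpen {X : Scheme.{u}}
    {V : X.Opens} (hV : IsAffineOpen V) (a : Γ(X, V)) {FT : Type u} [Field FT]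
    (φ : Γ(X, V) ⟶ CommRingCat.of FT)
    (h : Set.range (Spec.map φ ≫ hV.fromSpec) ⊆ X.basicOpen a) : φ.hom a ≠ 0 := by
  intro h0
  let x : Spec (CommRingCat.of FT) := (⊥ : PrimeSpectrum FT)
  have h1 : (Spec.map φ) x ∈ hV.fromSpec ⁻¹ᵁ X.basicOpen a := h ⟨x, rfl⟩
  rw [hV.fromSpec_preimage_basicOpen] at h1
  exact h1 (show φ.hom a ∈ x.asIdeal from h0 ▸ Ideal.zero_mem _)

lemma SpecMap_quotient_maximalIdeal_pow_apply (R : CommRingCat.{u}) [IsLocalRing R] (N : ℕ)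
    (y : Spec (CommRingCat.of (R ⧸ maximalIdeal R ^ N))) :
    Spec.map (CommRingCat.ofHom (Ideal.Quotient.mk (maximalIdeal R ^ N))) y = closedPoint R := by
  let mk : R ⟶ CommRingCat.of (R ⧸ maximalIdeal R ^ N) := CommRingCat.ofHom (Ideal.Quotient.mk _)
  refine PrimeSpectrum.ext ?_
  have h2 : maximalIdeal R ^ N ≤ ((Spec.map mk) y).asIdeal := fun r hr ↦ by
    change mk.hom r ∈ y.asIdeal
    have h3 : mk.hom r = 0 := Ideal.Quotient.eq_zero_iff_mem.mpr hr
    rw [h3]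
    exact Ideal.zero_mem _
  exact ((maximalIdeal.isMaximal R).eq_of_le ((Spec.map mk) y).2.ne_top
    (((Spec.map mk) y).2.le_of_pow_le h2)).symm

set_option maxHeartbeats 1000000 in
/-- Transport of infinitesimal arcs along a birational map `e` from `X'` to `X`. Let `R` be a
discrete valuation ring over `K` with maximal ideal `m` and `f` a point of `X'` in a quotient `Q` of
`R / m ^ n`. There is a point `fN` of `X` in some `R / m ^ N` such that every `R`-point `ψ` of `X`
extending `fN` corresponds under `e` to an `R`-point `ψ'` of `X'` extending `f`.

The point `f` need not lie in the domain of `e`. It is lifted to an arc of `X'` over a discrete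
valuation ring `S` unramified over `R` whose generic point lies in the domain of `e` (`exists_arc`).
As `X` is proper, `e` maps this arc to an arc of `X`, and `fN` is a truncation of the latter. The
truncation order `N` exceeds `n` by the precision lost when `ψ` is mapped back to `X'`
(`exists_lift_of_congr`). -/
lemma exists_approximation {K : Type u} [Field K] {X X' : Scheme.{u}}
    (sX : X ⟶ Spec (CommRingCat.of K)) (sX' : X' ⟶ Spec (CommRingCat.of K)) [IsProper sX]
    [Smooth sX'] [IsIntegral X'] (e : X'.PartialIso X) (he : e.IsOver sX' sX)
    {R Q : CommRingCat.{u}} [IsDomain R] [IsDiscreteValuationRing R] [IsLocalRing Q]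
    (k : CommRingCat.of K ⟶ R) (q : R ⟶ Q) (hq : Function.Surjective q.hom) {n : ℕ}
    (hn : maximalIdeal R ^ n ≤ RingHom.ker q.hom) (F : Type u) [Field F] [Algebra R F]
    [IsFractionRing R F] (f : Spec Q ⟶ X') (hf : f ≫ sX' = Spec.map (k ≫ q)) :
    ∃ (N : ℕ) (fN : Spec (CommRingCat.of (R ⧸ maximalIdeal R ^ N)) ⟶ X),
      fN ≫ sX = Spec.map (k ≫ CommRingCat.ofHom (Ideal.Quotient.mk _)) ∧ 0 < N ∧
      ∀ ψ : Spec R ⟶ X, ψ ≫ sX = Spec.map k →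
        Spec.map (CommRingCat.ofHom (Ideal.Quotient.mk (maximalIdeal R ^ N))) ≫ ψ = fN →
        ∃ ψ' : Spec R ⟶ X', ψ' ≫ sX' = Spec.map k ∧ Spec.map q ≫ ψ' = f ∧
          ∃ v : Spec (CommRingCat.of F) ⟶ e.source,
            v ≫ e.source.ι = Spec.map (CommRingCat.ofHom (algebraMap R F)) ≫ ψ' ∧
            v ≫ e.iso.hom ≫ e.target.ι = Spec.map (CommRingCat.ofHom (algebraMap R F)) ≫ ψ := by
  obtain ⟨V, hV, d, φ, hxV, hφ, hφC⟩ :=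
    Smooth.exists_etale_mvPolynomial sX' (f (closedPoint Q))
  obtain ⟨f₀, rfl⟩ := hV.exists_SpecMap_fromSpec_eq f (range_subset_of_closedPoint_mem f hxV)
  have : Nonempty V := ⟨_, hxV⟩
  -- `g` vanishes outside of the domain of the birational map
  obtain ⟨w, hwV, hwe⟩ := e.dense_source.inter_open_nonempty _ V.2 ⟨_, hxV⟩
  obtain ⟨g, hge, hwg⟩ := hV.exists_basicOpen_le ⟨w, hwe⟩ hwV
  have hg : g ≠ 0 := by
    rintro rfl
    simp at hwg
  let kA : CommRingCat.of K ⟶ Γ(X', V) := CommRingCat.ofHom (φ.comp MvPolynomial.C)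
  have hkA : Spec.map kA = hV.fromSpec ≫ sX' := hφC
  let := kA.hom.toAlgebra
  let := k.hom.toAlgebra
  let := q.hom.toAlgebra
  let : Algebra K Q := (k ≫ q).hom.toAlgebra
  have : IsScalarTower K R Q := .of_algebraMap_eq fun _ ↦ rfl
  have hf₀ : kA ≫ f₀ = k ≫ q := by
    apply Spec.map_injective
    rw [Spec.map_comp, hkA, ← hf, Category.assoc]
  let f₁ : Γ(X', V) →ₐ[K] Q :=
    { f₀.hom with commutes' := fun x ↦ congrArg (fun h ↦ h.hom x) hf₀ }
  let φ₁ : MvPolynomial (Fin d) K →ₐ[K] Γ(X', V) := { φ with commutes' := fun x ↦ rfl }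
  obtain ⟨S, _, _, _, _, _, _, hRS, α, hαg, hρ⟩ := exists_arc φ₁ hφ hg hq hn f₁
  let FS := FractionRing S
  let genS : Spec (CommRingCat.of FS) ⟶ Spec (CommRingCat.of S) :=
    Spec.map (CommRingCat.ofHom (algebraMap S FS))
  let αc : Γ(X', V) ⟶ CommRingCat.of S := CommRingCat.ofHom α.toRingHom
  let kS : CommRingCat.of K ⟶ CommRingCat.of S := CommRingCat.ofHom (algebraMap K S)
  have hαc : kA ≫ αc = kS := by ext x; exact α.commutes x
  -- the generic point of the arc lies in the domain of the birational map
  obtain ⟨uS, huS⟩ : ∃ uS : Spec (CommRingCat.of FS) ⟶ e.source,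
      uS ≫ e.source.ι = genS ≫ Spec.map αc ≫ hV.fromSpec := by
    have h : Set.range (genS ≫ Spec.map αc ≫ hV.fromSpec) ⊆ Set.range e.source.ι := by
      rw [Scheme.Opens.range_ι, ← Spec.map_comp_assoc]
      refine (hV.range_comp_fromSpec_subset_basicOpen g _ ?_).trans hge
      exact (map_ne_zero_iff _ (IsFractionRing.injective S FS)).mpr hαg
    exact ⟨IsOpenImmersion.lift e.source.ι _ h, IsOpenImmersion.lift_fac ..⟩
  obtain ⟨j, hj, hjS⟩ := IsProper.exists_lift sX (R := .of S) (uS ≫ e.iso.hom ≫ e.target.ι)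
    (Spec.map kS) <| by
    simp only [Category.assoc]
    rw [he, ← Category.assoc, huS, Category.assoc, Category.assoc, ← hkA, ← Spec.map_comp, hαc]
  obtain ⟨W, hW, hxW, -⟩ := exists_isAffineOpen_mem_and_subset
    (TopologicalSpace.Opens.mem_top (j (closedPoint S)))
  obtain ⟨β, rfl⟩ := hW.exists_SpecMap_fromSpec_eq j
    (range_subset_of_closedPoint_mem (R := CommRingCat.of S) j hxW)
  -- `b` cuts out a neighbourhood of the image of the generic point of the arc on which the inverse
  -- of the birational map is a morphism to `V`
  let pt : Spec (CommRingCat.of FS) := (⊥ : PrimeSpectrum FS)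
  have hrangeS : ∀ {Y : Scheme.{u}} (h : Spec (CommRingCat.of FS) ⟶ Y) {O : Y.Opens}, h pt ∈ O →
      Set.range h ⊆ O := by
    rintro Y h O hO _ ⟨x, rfl⟩
    obtain rfl : x = pt := Subsingleton.elim (α := PrimeSpectrum FS) x pt
    exact hO
  let O : X.Opens := e.target.ι ''ᵁ ((e.iso.inv ≫ e.source.ι) ⁻¹ᵁ V)
  have hOt : O ≤ e.target := by
    rintro _ ⟨y, -, rfl⟩
    exact y.2
  let x₀ : X := (genS ≫ Spec.map β ≫ hW.fromSpec) pt
  have hx₀W : x₀ ∈ W := by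
    have h : x₀ ∈ Set.range hW.fromSpec := ⟨(genS ≫ Spec.map β) pt, rfl⟩
    rwa [hW.range_fromSpec] at h
  have hx₀O : x₀ ∈ O := by
    refine ⟨(uS ≫ e.iso.hom) pt, ?_, ?_⟩
    · change ((uS ≫ e.iso.hom) ≫ e.iso.inv ≫ e.source.ι) pt ∈ V
      have h : (uS ≫ e.iso.hom) ≫ e.iso.inv ≫ e.source.ι = genS ≫ Spec.map αc ≫ hV.fromSpec := by
        simp [huS]
      rw [h]
      have h2 : (genS ≫ Spec.map αc ≫ hV.fromSpec) pt ∈ Set.range hV.fromSpec :=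
        ⟨(genS ≫ Spec.map αc) pt, rfl⟩
      rwa [hV.range_fromSpec] at h2
    · change (uS ≫ e.iso.hom ≫ e.target.ι) pt = _
      rw [← hj]
  obtain ⟨b, hbO, hxb⟩ := hW.exists_basicOpen_le ⟨x₀, hx₀O⟩ hx₀W
  have hD : IsAffineOpen (X.basicOpen b) := hW.basicOpen b
  have hloc : IsLocalization.Away b Γ(X, X.basicOpen b) := hW.isLocalization_basicOpen b
  let res : Γ(X, W) ⟶ Γ(X, X.basicOpen b) := CommRingCat.ofHom (algebraMap _ _)
  have hres : Spec.map res ≫ hW.fromSpec = hD.fromSpec :=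
    hW.map_fromSpec hD (homOfLE (X.basicOpen_le b)).op
  have hDt : Set.range hD.fromSpec ⊆ Set.range e.target.ι := by
    rw [hD.range_fromSpec, Scheme.Opens.range_ι]
    exact hbO.trans hOt
  let l : Spec Γ(X, X.basicOpen b) ⟶ e.target := IsOpenImmersion.lift e.target.ι hD.fromSpec hDt
  have hl : l ≫ e.target.ι = hD.fromSpec := IsOpenImmersion.lift_fac ..
  obtain ⟨θ, hθ⟩ := hV.exists_SpecMap_fromSpec_eq (l ≫ e.iso.inv ≫ e.source.ι) <| by
    rintro _ ⟨y, rfl⟩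
    have h1 : hD.fromSpec y ∈ O := by
      have h2 : hD.fromSpec y ∈ Set.range hD.fromSpec := ⟨y, rfl⟩
      rw [hD.range_fromSpec] at h2
      exact hbO h2
    obtain ⟨z, hz, hzy⟩ := h1
    rw [← hl, Scheme.Hom.comp_apply] at hzy
    obtain rfl : z = l y := e.target.ι.isOpenEmbedding.injective hzy
    exact hz
  let kB : CommRingCat.of K ⟶ Γ(X, W) := Spec.preimage (hW.fromSpec ≫ sX)
  have hkB : Spec.map kB = hW.fromSpec ≫ sX := Spec.map_preimage _
  have hkθ : kA ≫ θ = kB ≫ res := by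
    apply Spec.map_injective
    rw [Spec.map_comp, Spec.map_comp, hkA, hkB, ← Category.assoc, hθ,
      ← Category.assoc (Spec.map res), hres, ← hl]
    simp only [Category.assoc]
    rw [← he, Iso.inv_hom_id_assoc]
  let := kB.hom.toAlgebra
  let : Algebra K Γ(X, X.basicOpen b) := (kB ≫ res).hom.toAlgebra
  have : IsScalarTower K Γ(X, W) Γ(X, X.basicOpen b) := .of_algebraMap_eq fun _ ↦ rfl
  let θ₁ : Γ(X', V) →ₐ[K] Γ(X, X.basicOpen b) :=
    { θ.hom with commutes' := fun x ↦ congrArg (fun h ↦ h.hom x) hkθ }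
  have hkβ : kB ≫ β = kS := by
    apply Spec.map_injective
    rw [Spec.map_comp, hkB, ← hjS, Category.assoc]
  let β₁ : Γ(X, W) →ₐ[K] S :=
    { β.hom with commutes' := fun x ↦ congrArg (fun h ↦ h.hom x) hkβ }
  have hβb : β₁ b ≠ 0 := by
    have h := hW.map_ne_zero_of_range_subset_basicOpen b
      (β ≫ CommRingCat.ofHom (algebraMap S FS)) <| by
      rw [Spec.map_comp, Category.assoc]
      exact hrangeS _ hxb
    intro h0
    refine h ?_
    change algebraMap S FS (β₁ b) = 0
    rw [h0, map_zero]
  -- clearing denominators in an equality of morphisms at the generic point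
  have clear : ∀ {T FT : Type u} [CommRing T] [Field FT] [Algebra T FT] [FaithfulSMul T FT]
      (a' : Γ(X', V) ⟶ CommRingCat.of T) (b' : Γ(X, W) ⟶ CommRingCat.of T)
      (c' : Γ(X, X.basicOpen b) ⟶ CommRingCat.of FT),
      res ≫ c' = b' ≫ CommRingCat.ofHom (algebraMap T FT) →
      θ ≫ c' = a' ≫ CommRingCat.ofHom (algebraMap T FT) → ∀ a k x,
      θ a * res (b ^ k) = res x → a' a * b' (b ^ k) = b' x := by
    intro T FT _ _ _ _ a' b' c' h1 h2 a k x hx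
    apply FaithfulSMul.algebraMap_injective T FT
    rw [map_mul]
    have h1' : ∀ y, c'.hom (res.hom y) = algebraMap T FT (b'.hom y) := fun y ↦
      congrArg (fun h ↦ h.hom y) h1
    have h2' : ∀ y, c'.hom (θ.hom y) = algebraMap T FT (a'.hom y) := fun y ↦
      congrArg (fun h ↦ h.hom y) h2
    rw [← h1', ← h1', ← h2', ← map_mul, hx]
  obtain ⟨cS, hcS⟩ := exists_hom_of_isLocalizationAway (Bb := Γ(X, X.basicOpen b)) (FT := FS) b β hβb
  have hθS : θ ≫ cS = αc ≫ CommRingCat.ofHom (algebraMap S FS) := by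
    have h1 : Spec.map cS ≫ l = uS ≫ e.iso.hom := by
      rw [← cancel_mono e.target.ι, Category.assoc, hl, Category.assoc, ← hj, ← hres,
        ← Spec.map_comp_assoc, ← Spec.map_comp_assoc, hcS]
    apply Spec.map_injective
    rw [← cancel_mono hV.fromSpec, Spec.map_comp, Category.assoc, hθ, ← Category.assoc, h1,
      Category.assoc, Iso.hom_inv_id_assoc, huS, Spec.map_comp, Category.assoc]
  have : LocallyOfFiniteType sX' := inferInstance
  have : Algebra.FiniteType K Γ(X', V) := by
    have h1 : LocallyOfFiniteType (Spec.map kA) := hkA ▸ inferInstance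
    exact (HasRingHomProperty.Spec_iff (P := @LocallyOfFiniteType)).mp h1
  obtain ⟨c, hc⟩ := exists_lift_of_congr hRS b θ₁ α β₁ hβb (clear αc β cS hcS hθS)
  let N := c + n + 1
  obtain ⟨ρ, hρ⟩ := hρ N (by omega)
  let ρc : CommRingCat.of S ⟶ CommRingCat.of (R ⧸ maximalIdeal R ^ N) :=
    CommRingCat.ofHom ρ.toRingHom
  let mk : R ⟶ CommRingCat.of (R ⧸ maximalIdeal R ^ N) := CommRingCat.ofHom (Ideal.Quotient.mk _)
  have hkρ : kS ≫ ρc = k ≫ mk := by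
    ext x
    exact (ρ.restrictScalars K).commutes x
  refine ⟨N, Spec.map (β ≫ ρc) ≫ hW.fromSpec, ?_, by omega, fun ψ hψ hψN ↦ ?_⟩
  · rw [Category.assoc, ← hkB, ← Spec.map_comp, ← Category.assoc, hkβ, hkρ]
  have hψW : ψ (closedPoint R) ∈ W := by
    have := nontrivial_quotient_maximalIdeal_pow R (N := N) (by omega)
    obtain ⟨y⟩ : Nonempty (Spec (CommRingCat.of (R ⧸ maximalIdeal R ^ N))) :=
      inferInstanceAs (Nonempty (PrimeSpectrum _))
    have h1 : (Spec.map mk) y = closedPoint R := SpecMap_quotient_maximalIdeal_pow_apply R N y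
    rw [← h1, ← Scheme.Hom.comp_apply, hψN, Scheme.Hom.comp_apply]
    have h4 : hW.fromSpec ((Spec.map (β ≫ ρc)) y) ∈ Set.range hW.fromSpec := ⟨_, rfl⟩
    rwa [hW.range_fromSpec] at h4
  obtain ⟨ψ₀, rfl⟩ := hW.exists_SpecMap_fromSpec_eq ψ (range_subset_of_closedPoint_mem ψ hψW)
  have hψ₀ : ψ₀ ≫ mk = β ≫ ρc := by
    apply Spec.map_injective
    rw [← cancel_mono hW.fromSpec, ← hψN, Spec.map_comp, Category.assoc]
  have hkψ : kB ≫ ψ₀ = k := by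
    apply Spec.map_injective
    rw [Spec.map_comp, hkB, ← hψ, Category.assoc]
  let ψ₁ : Γ(X, W) →ₐ[K] R :=
    { ψ₀.hom with commutes' := fun x ↦ congrArg (fun h ↦ h.hom x) hkψ }
  obtain ⟨hψb, h, hh, hhα⟩ := hc N (by omega) ρ ψ₁ fun x ↦ congrArg (fun h ↦ h.hom x) hψ₀
  let hR : Γ(X', V) ⟶ R := CommRingCat.ofHom h.toRingHom
  have hkh : kA ≫ hR = k := by ext x; exact h.commutes x
  obtain ⟨cR, hcR⟩ := exists_hom_of_isLocalizationAway (Bb := Γ(X, X.basicOpen b)) (T := R) (FT := F)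
    b ψ₀ hψb
  have hθR : θ ≫ cR = hR ≫ CommRingCat.ofHom (algebraMap R F) := by
    ext a
    obtain ⟨⟨x, ⟨_, i, rfl⟩⟩, hx⟩ := IsLocalization.surj (Submonoid.powers b) (θ₁ a)
    have h1 := hh a i x hx
    have h2 := congrArg cR.hom hx
    have h3 : ∀ y, cR.hom (res.hom y) = algebraMap R F (ψ₀.hom y) := fun y ↦
      congrArg (fun h ↦ h.hom y) hcR
    rw [map_mul] at h2
    have h4 : algebraMap R F (ψ₀.hom (b ^ i)) ≠ 0 := by
      rw [map_ne_zero_iff _ (IsFractionRing.injective R F), map_pow]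
      exact pow_ne_zero _ hψb
    refine mul_right_cancel₀ h4 ?_
    change cR.hom (θ.hom a) * _ = algebraMap R F (h a) * algebraMap R F (ψ₁ (b ^ i))
    rw [← map_mul, h1, ← h3]
    exact h2.trans (h3 x)
  refine ⟨Spec.map hR ≫ hV.fromSpec, ?_, ?_, Spec.map cR ≫ l ≫ e.iso.inv, ?_, ?_⟩
  · rw [Category.assoc, ← hkA, ← Spec.map_comp, hkh]
  · rw [← Spec.map_comp_assoc]
    congr 2
    ext a
    obtain ⟨r, hr⟩ := Ideal.Quotient.mk_surjective (ρ (α a))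
    have h1 : h a - r ∈ maximalIdeal R ^ n := Ideal.pow_le_pow_right (by omega) (hhα a r hr)
    have h2 : q.hom (h a - r) = 0 := hn h1
    change q.hom (h a) = f₁ a
    rw [← hρ a r hr, ← sub_eq_zero]
    change q.hom (h a) - q.hom r = 0
    rw [← map_sub, h2]
  · simp only [Category.assoc]
    rw [← hθ, ← Spec.map_comp_assoc, hθR, Spec.map_comp, Category.assoc]
  · simp only [Category.assoc, Iso.inv_hom_id_assoc]
    rw [hl, ← hres, ← Spec.map_comp_assoc, hcR, Spec.map_comp, Category.assoc]

/-! ### Projective schemes are proper -/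

lemma ProjectiveSpaceOver.isProper_structureMap (K : Type u) [Field K] (n : ℕ) :
    IsProper (ProjectiveSpaceOver.structureMap K n) := by
  let 𝒜 := MvPolynomial.homogeneousSubmodule (Fin (n + 1)) K
  have : IsScalarTower K (𝒜 0) (MvPolynomial (Fin (n + 1)) K) := .of_algebraMap_eq (R := K) (S := 𝒜 0)
    (A := MvPolynomial (Fin (n + 1)) K) fun _ ↦ rfl
  have : Algebra.FiniteType (𝒜 0) (MvPolynomial (Fin (n + 1)) K) :=
    .of_restrictScalars_finiteType K _ _
  have hsurj : Function.Surjective (algebraMap K (𝒜 0)) := by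
    rintro ⟨p, hp⟩
    refine ⟨MvPolynomial.coeff 0 p, Subtype.ext ?_⟩
    have h := (MvPolynomial.totalDegree_eq_zero_iff_eq_C (p := p)).mp
      (Nat.le_zero.mp ((MvPolynomial.mem_homogeneousSubmodule 0 p).mp hp).totalDegree_le)
    exact h.symm
  have : IsClosedImmersion (Spec.map (CommRingCat.ofHom (algebraMap K (𝒜 0)))) :=
    IsClosedImmersion.spec_of_surjective _ hsurj
  have : IsProper (Proj.toSpecZero 𝒜) := inferInstance
  unfold ProjectiveSpaceOver.structureMap
  exact MorphismProperty.comp_mem _ _ _ this inferInstance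

lemma IsProjectiveOver.isProper {K : Type u} [Field K] {X : Scheme.{u}}
    {sX : X ⟶ Spec (CommRingCat.of K)} (h : IsProjectiveOver sX) : IsProper sX := by
  obtain ⟨n, j, _, rfl⟩ := h
  have := ProjectiveSpaceOver.isProper_structureMap K n
  exact MorphismProperty.comp_mem _ _ _ inferInstance this

/-! ### Morphisms out of curves -/

/-- The local rings of a smooth integral curve over a field have principal maximal ideals. -/
lemma isPrincipal_maximalIdeal_stalk {K : Type u} [Field K] {C : Scheme.{u}} [IsIntegral C]
    (sC : C ⟶ Spec (CommRingCat.of K)) [SmoothOfRelativeDimension 1 sC] (c : C) :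
    (maximalIdeal (C.presheaf.stalk c)).IsPrincipal := by
  obtain ⟨U, hU, V, hV, hc, e, h⟩ :=
    SmoothOfRelativeDimension.exists_isStandardSmoothOfRelativeDimension (n := 1) (f := sC) c
  obtain ⟨φ, hφ, -⟩ := IsAffineOpen.exists_etale_mvPolynomial sC hU hV hc e h
  have : IsPrincipalIdealRing (MvPolynomial (Fin 1) K) :=
    IsPrincipalIdealRing.of_surjective (MvPolynomial.uniqueAlgEquiv K (Fin 1)).symm
      (MvPolynomial.uniqueAlgEquiv K (Fin 1)).symm.surjective
  algebraize [φ]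
  let q := (hV.primeIdealOf ⟨c, hc⟩).asIdeal
  have h1 : (maximalIdeal (Localization.AtPrime q)).IsPrincipal :=
    isPrincipal_maximalIdeal_of_etale (MvPolynomial (Fin 1) K) q
  let := C.presheaf.algebra_section_stalk ⟨c, hc⟩
  have := hV.isLocalization_stalk ⟨c, hc⟩
  let E := IsLocalization.algEquiv q.primeCompl (Localization.AtPrime q) (C.presheaf.stalk c)
  rw [← map_maximalIdeal_of_surjective E.toRingEquiv.toRingHom E.surjective]
  infer_instance

instance isDominant_fromSpecStalk_genericPoint (C : Scheme.{u}) [IrreducibleSpace C] :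
    IsDominant (C.fromSpecStalk (genericPoint C)) := by
  have h : genericPoint C ∈ Set.range (C.fromSpecStalk (genericPoint C)) :=
    ⟨closedPoint _, Scheme.fromSpecStalk_closedPoint⟩
  exact ⟨(dense_iff_closure_eq.mpr (genericPoint_spec C)).mono (Set.singleton_subset_iff.mpr h)⟩

/-- A morphism from the generic point of an integral scheme all of whose local rings are valuation
rings to a proper scheme extends to the whole scheme: by the valuative criterion, the rational map
that it defines is defined at every point. -/
lemma exists_extension {S C X : Scheme.{u}} [IsIntegral C] [S.IsSeparated]
    (hC : ∀ c : C, ValuationRing (C.presheaf.stalk c)) (sC : C ⟶ S) (sX : X ⟶ S) [IsProper sX]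
    (v : Spec C.functionField ⟶ X) (hv : v ≫ sX = C.fromSpecStalk _ ≫ sC) :
    ∃ Φ : C ⟶ X, Φ ≫ sX = sC ∧ C.fromSpecStalk _ ≫ Φ = v := by
  have : X.IsSeparated := by
    rw [Scheme.isSeparated_iff, ← Limits.terminal.comp_from sX]
    infer_instance
  let r := Scheme.RationalMap.ofFunctionField sC sX v hv
  have hr : r.domain = ⊤ := by
    refine top_le_iff.mp fun c _ ↦ ?_
    have := hC c
    obtain ⟨ψ, hψ, hψS⟩ := IsProper.exists_lift sX (R := C.presheaf.stalk c) (F := C.functionField)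
      v (C.fromSpecStalk c ≫ sC) <| by
        rw [hv]
        exact (Scheme.SpecMap_stalkSpecializes_fromSpecStalk_assoc
          ((genericPoint_spec C).specializes trivial) sC).symm
    let g := Scheme.PartialMap.ofFromSpecStalk sC sX ψ hψS
    have hg : c ∈ g.domain := Scheme.PartialMap.mem_domain_ofFromSpecStalk sC sX ψ hψS
    refine Scheme.RationalMap.mem_domain.mpr ⟨g, hg, ?_⟩
    apply Scheme.RationalMap.eq_of_fromFunctionField_eq
    rw [Scheme.RationalMap.fromFunctionField_toRationalMap,
      Scheme.RationalMap.fromFunctionField_ofFunctionField, ← hψ,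
      ← Scheme.PartialMap.fromSpecStalkOfMem_ofFromSpecStalk sC sX ψ hψS]
    unfold Scheme.PartialMap.fromFunctionField Scheme.PartialMap.fromSpecStalkOfMem
    rw [← Category.assoc]
    congr 1
    rw [← cancel_mono (Scheme.Opens.ι _), Category.assoc, Scheme.Opens.fromSpecStalkOfMem_ι,
      Scheme.Opens.fromSpecStalkOfMem_ι]
    exact (Scheme.SpecMap_stalkSpecializes_fromSpecStalk
          ((genericPoint_spec C).specializes trivial)).symm
  obtain ⟨Φ, hΦ⟩ : ∃ Φ : C ⟶ X, r = Φ.toRationalMap := by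
    obtain ⟨p, hp, hpr⟩ : ∃ p : C.PartialMap X, p.domain = ⊤ ∧ p.toRationalMap = r :=
      ⟨r.toPartialMap, hr, r.toRationalMap_toPartialMap⟩
    obtain ⟨U, hU, f⟩ := p
    obtain rfl : U = ⊤ := hp
    refine ⟨C.topIso.inv ≫ f, ?_⟩
    rw [← hpr, Scheme.Hom.toRationalMap]
    congr 1
    refine Scheme.PartialMap.ext _ _ rfl ?_
    simp [Scheme.Hom.toPartialMap]
  have hΦv : C.fromSpecStalk _ ≫ Φ = v := by
    have h1 := congrArg Scheme.RationalMap.fromFunctionField hΦ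
    rw [Scheme.RationalMap.fromFunctionField_ofFunctionField] at h1
    rw [h1]
    exact (Scheme.PartialMap.fromSpecStalkOfMem_toPartialMap Φ _).symm
  refine ⟨Φ, ?_, hΦv⟩
  apply ext_of_isDominant (C.fromSpecStalk (genericPoint C))
  rw [← hv, ← hΦv, Category.assoc]

/-- A morphism out of a locally noetherian scheme is determined by its restrictions to the local
schemes. -/
lemma eq_of_fromSpecStalk {Y Z : Scheme.{u}} [IsLocallyNoetherian Z] (f g : Z ⟶ Y)
    (h : ∀ z, Z.fromSpecStalk z ≫ f = Z.fromSpecStalk z ≫ g) : f = g := by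
  choose U hzU hU using fun z ↦ spread_out_unique_of_isGermInjective' f g (h z)
  refine (Z.openCoverOfIsOpenCover U (.mk ?_)).hom_ext _ _ hU
  exact top_le_iff.mp fun z _ ↦ TopologicalSpace.Opens.mem_iSup.mpr ⟨z, hzU z⟩

lemma isDominant_SpecMap_algebraMap (R : CommRingCat.{u}) (F : Type u) [CommRing F] [Algebra R F]
    [FaithfulSMul R F] : IsDominant (Spec.map (CommRingCat.ofHom (algebraMap R F))) := by
  refine ⟨(PrimeSpectrum.denseRange_comap_iff_ker_le_nilRadical (algebraMap R F)).mpr ?_⟩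
  rw [(RingHom.injective_iff_ker_eq_bot _).mp (FaithfulSMul.algebraMap_injective R F)]
  exact bot_le

/-- A closed subscheme of an irreducible scheme whose ideal has a vanishing stalk at one of its points
contains the generic point. -/
lemma mem_range_of_injective_stalkMap {Z C : Scheme.{u}} [IrreducibleSpace C] (i : Z ⟶ C)
    [IsClosedImmersion i] (z : Z) (h : Function.Injective (i.stalkMap z).hom) :
    genericPoint C ∈ Set.range i := by
  have h1 : IsIso (i.stalkMap z) :=
    (ConcreteCategory.isIso_iff_bijective _).mpr ⟨h, i.stalkMap_surjective z⟩
  have h2 : genericPoint C ∈ Set.range (C.fromSpecStalk (i z)) := by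
    rw [Scheme.range_fromSpecStalk]
    exact (genericPoint_spec C).specializes trivial
  obtain ⟨y, hy⟩ := h2
  refine ⟨Z.fromSpecStalk z ((inv (Spec.map (i.stalkMap z))) y), ?_⟩
  rw [← Scheme.Hom.comp_apply, ← Scheme.SpecMap_stalkMap_fromSpecStalk, ← Scheme.Hom.comp_apply,
    IsIso.inv_hom_id_assoc, hy]

lemma eq_genericPoint_of_isField_stalk {C : Scheme.{u}} [IsIntegral C] {c : C}
    (h : IsField (C.presheaf.stalk c)) : c = genericPoint C := by
  have h2 : genericPoint C ∈ Set.range (C.fromSpecStalk c) := by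
    rw [Scheme.range_fromSpecStalk]
    exact (genericPoint_spec C).specializes trivial
  obtain ⟨y, hy⟩ := h2
  have h4 : y = closedPoint _ := PrimeSpectrum.ext <|
    le_antisymm (le_maximalIdeal y.2.ne_top) ((isField_iff_maximalIdeal_eq.mp h).trans_le bot_le)
  rw [← hy, h4, Scheme.fromSpecStalk_closedPoint]

/-! ### Infinitesimal neighbourhoods of closed points -/

lemma topologicalKrullDim_eq_zero_of_discreteTopology (T : Type*) [TopologicalSpace T]
    [DiscreteTopology T] [Nonempty T] : topologicalKrullDim T = 0 := by
  refine le_antisymm (topologicalKrullDim_zero_of_discreteTopology T) ?_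
  obtain ⟨t⟩ := ‹Nonempty T›
  have : Nonempty (TopologicalSpace.IrreducibleCloseds T) :=
    ⟨⟨{t}, isIrreducible_singleton, isClosed_discrete _⟩⟩
  exact Order.krullDim_nonneg

lemma nonempty_of_topologicalKrullDim_eq_zero (T : Type*) [TopologicalSpace T]
    (h : topologicalKrullDim T = 0) : Nonempty T := by
  by_contra hT
  rw [not_nonempty_iff] at hT
  have : IsEmpty (TopologicalSpace.IrreducibleCloseds T) :=
    ⟨fun A ↦ A.isIrreducible.nonempty.elim fun t _ ↦ hT.elim t⟩
  rw [topologicalKrullDim, Order.krullDim_eq_bot] at h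
  exact WithBot.bot_ne_zero h

lemma quotient_fromSpecStalk_apply {C : Scheme.{u}} (c : C) (N : ℕ)
    (y : Spec (CommRingCat.of (C.presheaf.stalk c ⧸ maximalIdeal (C.presheaf.stalk c) ^ N))) :
    (Spec.map (CommRingCat.ofHom
      (Ideal.Quotient.mk (maximalIdeal (C.presheaf.stalk c) ^ N))) ≫ C.fromSpecStalk c) y = c := by
  have h := SpecMap_quotient_maximalIdeal_pow_apply (C.presheaf.stalk c) N y
  rw [Scheme.Hom.comp_apply]
  exact (congrArg _ h).trans Scheme.fromSpecStalk_closedPoint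

/-- The infinitesimal neighbourhood of order `N` of a closed point `c` of a scheme is a closed
subscheme. -/
lemma isClosedImmersion_fromSpecStalk_quotient {C : Scheme.{u}} {c : C} (hc : IsClosed {c})
    {N : ℕ} (hN : 0 < N) :
    IsClosedImmersion (Spec.map (CommRingCat.ofHom
      (Ideal.Quotient.mk (maximalIdeal (C.presheaf.stalk c) ^ N))) ≫ C.fromSpecStalk c) := by
  have := IsClosedImmersion.spec_of_surjective (CommRingCat.ofHom
      (Ideal.Quotient.mk (maximalIdeal (C.presheaf.stalk c) ^ N))) Ideal.Quotient.mk_surjective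
  have := nontrivial_quotient_maximalIdeal_pow (C.presheaf.stalk c) hN
  have : Nonempty (Spec (CommRingCat.of (C.presheaf.stalk c ⧸
    maximalIdeal (C.presheaf.stalk c) ^ N))) := inferInstanceAs (Nonempty (PrimeSpectrum _))
  refine IsClosedImmersion.of_isPreimmersion _ ?_
  rwa [show Set.range _ = {c} from Set.range_eq_singleton_iff.mpr
    (quotient_fromSpecStalk_apply c N)]

instance subsingleton_Spec_quotient_maximalIdeal_pow (R : CommRingCat.{u}) [IsLocalRing R] (N : ℕ) :
    Subsingleton (Spec (CommRingCat.of (R ⧸ maximalIdeal R ^ N))) := by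
  have := IsClosedImmersion.spec_of_surjective (CommRingCat.ofHom
      (Ideal.Quotient.mk (maximalIdeal R ^ N))) Ideal.Quotient.mk_surjective
  exact ⟨fun y y' ↦ (Scheme.Hom.isClosedEmbedding _).injective
    ((SpecMap_quotient_maximalIdeal_pow_apply R N y).trans
      (SpecMap_quotient_maximalIdeal_pow_apply R N y').symm)⟩

/-- Finitely many closed subschemes with pairwise disjoint supports form a closed subscheme. -/
lemma isClosedImmersion_sigmaDesc {ι : Type u} [Finite ι] {C : Scheme.{u}} (Y : ι → Scheme.{u})
    (f : ∀ i, Y i ⟶ C) [∀ i, IsClosedImmersion (f i)]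
    (hf : ∀ i j (y : Y i) (y' : Y j), f i y = f j y' → i = j) :
    IsClosedImmersion (Limits.Sigma.desc f) := by
  have hι : ∀ i (y : Y i), Limits.Sigma.desc f (Limits.Sigma.ι Y i y) = f i y := fun i y ↦ by
    rw [← Scheme.Hom.comp_apply, Limits.Sigma.ι_desc]
  have hex : ∀ x : (∐ Y :), ∃ i y, Limits.Sigma.ι Y i y = x := fun x ↦ by
    obtain ⟨⟨i, y⟩, rfl⟩ := (sigmaMk Y).surjective x
    exact ⟨i, y, (sigmaMk_mk Y i y).symm⟩
  have : SurjectiveOnStalks (Limits.Sigma.desc f) := by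
    constructor
    intro x
    obtain ⟨i, y, rfl⟩ := hex x
    have h1 : Function.Surjective ((Limits.Sigma.ι Y i ≫ Limits.Sigma.desc f).stalkMap y) := by
      rw [Limits.Sigma.ι_desc]
      exact (f i).stalkMap_surjective y
    rw [Scheme.Hom.stalkMap_comp] at h1
    have h2 := (ConcreteCategory.bijective_of_isIso ((Limits.Sigma.ι Y i).stalkMap y)).1
    intro a
    obtain ⟨b, hb⟩ := h1 ((Limits.Sigma.ι Y i).stalkMap y a)
    exact ⟨b, h2 hb⟩
  refine ⟨.of_continuous_injective_isClosedMap (Scheme.Hom.continuous _) ?_ ?_⟩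
  · intro x x' h
    obtain ⟨i, y, rfl⟩ := hex x
    obtain ⟨j, y', rfl⟩ := hex x'
    rw [hι, hι] at h
    obtain rfl := hf _ _ _ _ h
    rw [(f i).isClosedEmbedding.injective h]
  · intro A hA
    have : Limits.Sigma.desc f '' A = ⋃ i, f i '' (Limits.Sigma.ι Y i ⁻¹' A) := by
      ext c
      simp only [Set.mem_image, Set.mem_iUnion, Set.mem_preimage]
      constructor
      · rintro ⟨x, hx, rfl⟩
        obtain ⟨i, y, rfl⟩ := hex x
        exact ⟨i, y, hx, (hι i y).symm⟩
      · rintro ⟨i, y, hy, rfl⟩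
        exact ⟨_, hy, hι i y⟩
    rw [this]
    exact isClosed_iUnion_of_finite fun i ↦ (f i).isClosedEmbedding.isClosedMap _
      (hA.preimage (Scheme.Hom.continuous _))

/-! ### Birational invariance of the extension conjecture -/

theorem proposition4p5 {K : Type u} [Field K] {X X' : Scheme.{u}}
    (sX : X ⟶ Spec (CommRingCat.of K)) (sX' : X' ⟶ Spec (CommRingCat.of K))
    (hX : IsSmoothProjectiveVariety sX) (hX' : IsSmoothProjectiveVariety sX')
    (hbir : Scheme.BirationalOver sX sX')
    (hconj : ExtensionConjectureHolds sX) :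
    ExtensionConjectureHolds sX' := by
  intro C sC hC Z i hi hZ φ hφ
  have := hC.isIntegral
  have := hC.smooth
  have : Smooth sC := SmoothOfRelativeDimension.smooth 1 sC
  have := hX.projective.isProper
  have := hX'.projective.isProper
  have := hX'.smooth
  have := hX'.isIntegral
  obtain ⟨e, he⟩ := hbir.symm
  -- a closed subscheme through the generic point is all of the reduced scheme `C`
  by_cases hη : genericPoint C ∈ Set.range i
  · have : Surjective i := by
      refine ⟨Set.range_eq_univ.mp (Set.eq_univ_of_univ_subset ?_)⟩
      rw [← genericPoint_spec C]
      exact closure_minimal (Set.singleton_subset_iff.mpr hη) i.isClosedEmbedding.isClosed_range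
    have := isIso_of_isClosedImmersion_of_surjective i
    exact ⟨inv i ≫ φ, by rw [Category.assoc, hφ, IsIso.inv_hom_id_assoc], IsIso.hom_inv_id_assoc i φ⟩
  have : IsLocallyNoetherian C := LocallyOfFiniteType.isLocallyNoetherian sC
  have : IsLocallyNoetherian Z := LocallyOfFiniteType.isLocallyNoetherian i
  have : IsLocallyArtinian Z := .of_topologicalKrullDim_le_zero hZ.le
  have : DiscreteTopology Z := 
    (IsLocallyArtinian.iff_isLocallyNoetherian_and_discreteTopology.mp ‹_›).2
  have := hC.projective.isProper
  have : CompactSpace C := QuasiCompact.compactSpace_of_compactSpace sC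
  have : CompactSpace Z := QuasiCompact.compactSpace_of_compactSpace i
  have : Finite Z := finite_of_compact_of_discrete
  have hprin := isPrincipal_maximalIdeal_stalk sC
  have hdvr : ∀ z : Z, IsDiscreteValuationRing (C.presheaf.stalk (i z)) := fun z ↦ by
    have hnf : ¬ IsField (C.presheaf.stalk (i z)) := fun h ↦
      hη ⟨z, eq_genericPoint_of_isField_stalk h⟩
    exact ((IsDiscreteValuationRing.TFAE _ hnf).out 4 0).mp (hprin _)
  have hker : ∀ z : Z, ∃ n, maximalIdeal (C.presheaf.stalk (i z)) ^ n ≤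
      RingHom.ker (i.stalkMap z).hom := fun z ↦ by
    have h1 : RingHom.ker (i.stalkMap z).hom ≠ ⊥ := fun h ↦
      hη (mem_range_of_injective_stalkMap i z ((RingHom.injective_iff_ker_eq_bot _).mpr h))
    obtain ⟨n, hn⟩ := exists_maximalIdeal_pow_eq_of_principal _ (hprin _) _ h1
    exact ⟨n, hn.ge⟩
  choose n hn using hker
  let k (z : Z) : CommRingCat.of K ⟶ C.presheaf.stalk (i z) :=
    Spec.preimage (C.fromSpecStalk (i z) ≫ sC)
  have hk : ∀ z, Spec.map (k z) = C.fromSpecStalk (i z) ≫ sC := fun z ↦ Spec.map_preimage _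
  choose N fN hfN hN happrox using fun z ↦ exists_approximation sX sX' e he (k z) (i.stalkMap z)
    (i.stalkMap_surjective z) (hn z) C.functionField (Z.fromSpecStalk z ≫ φ) (by
      rw [Category.assoc, hφ, Spec.map_comp, hk, Scheme.SpecMap_stalkMap_fromSpecStalk_assoc])
  have := nonempty_of_topologicalKrullDim_eq_zero Z hZ
  let Y (z : Z) : Scheme.{u} :=
    Spec (CommRingCat.of (C.presheaf.stalk (i z) ⧸ maximalIdeal (C.presheaf.stalk (i z)) ^ N z))
  let τ (z : Z) : Y z ⟶ C :=
    Spec.map (CommRingCat.ofHom (Ideal.Quotient.mk _)) ≫ C.fromSpecStalk (i z)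
  -- the disjoint union of the thickenings `Y z` is a zero-dimensional closed subscheme of `C`
  have hτ : ∀ z, IsClosedImmersion (τ z) := fun z ↦ by
    refine isClosedImmersion_fromSpecStalk_quotient ?_ (hN z)
    rw [← Set.image_singleton]
    exact i.isClosedEmbedding.isClosedMap _ (isClosed_discrete _)
  have hτ' : IsClosedImmersion (Limits.Sigma.desc τ) := by
    refine isClosedImmersion_sigmaDesc Y τ fun z z' y y' h ↦ i.isClosedEmbedding.injective ?_
    exact ((quotient_fromSpecStalk_apply _ _ y).symm.trans h).trans
      (quotient_fromSpecStalk_apply _ _ y')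
  have hdim : topologicalKrullDim (∐ Y :) = 0 := by
    have : ∀ z, Subsingleton (Y z) := fun z ↦
      subsingleton_Spec_quotient_maximalIdeal_pow (C.presheaf.stalk (i z)) (N z)
    have : ∀ z, DiscreteTopology (Y z) := fun z ↦ inferInstance
    have : DiscreteTopology (∐ Y :) := (sigmaMk Y).symm.isEmbedding.discreteTopology
    have : Nonempty (∐ Y :) := by
      obtain ⟨z⟩ := ‹Nonempty Z›
      have := nontrivial_quotient_maximalIdeal_pow (C.presheaf.stalk (i z)) (hN z)
      obtain ⟨y⟩ : Nonempty (Y z) := inferInstanceAs (Nonempty (PrimeSpectrum _))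
      exact ⟨sigmaMk Y ⟨z, y⟩⟩
    exact topologicalKrullDim_eq_zero_of_discreteTopology _
  obtain ⟨Ψ, hΨ, hΨf⟩ := hconj C sC hC (∐ Y) (Limits.Sigma.desc τ) hτ' hdim (Limits.Sigma.desc fN)
    (Limits.Sigma.hom_ext _ _ fun z ↦ by
      rw [Limits.Sigma.ι_desc_assoc, Limits.Sigma.ι_desc_assoc, hfN, Spec.map_comp, hk]
      exact (Category.assoc _ _ _).symm)
  let gen (z : Z) : Spec C.functionField ⟶ Spec (C.presheaf.stalk (i z)) :=
    Spec.map (CommRingCat.ofHom (algebraMap (C.presheaf.stalk (i z)) C.functionField))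
  have hgen (z : Z) : gen z ≫ C.fromSpecStalk (i z) = C.fromSpecStalk (genericPoint C) :=
    Scheme.SpecMap_stalkSpecializes_fromSpecStalk ((genericPoint_spec C).specializes trivial)
  have hlift : ∀ z, ∃ ψ' : Spec (C.presheaf.stalk (i z)) ⟶ X', ψ' ≫ sX' = Spec.map (k z) ∧
      Spec.map (i.stalkMap z) ≫ ψ' = Z.fromSpecStalk z ≫ φ ∧
      ∃ v : Spec C.functionField ⟶ e.source, v ≫ e.source.ι = gen z ≫ ψ' ∧
        v ≫ e.iso.hom ≫ e.target.ι = C.fromSpecStalk (genericPoint C) ≫ Ψ := fun z ↦ by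
    obtain ⟨ψ', h1, h2, v, h3, h4⟩ := happrox z (C.fromSpecStalk (i z) ≫ Ψ)
      (by rw [Category.assoc, hΨ, hk]) (by
        have h := congrArg (Limits.Sigma.ι Y z ≫ ·) hΨf
        simp only [Limits.Sigma.ι_desc, Limits.Sigma.ι_desc_assoc] at h
        exact (Category.assoc _ _ _).symm.trans h)
    refine ⟨ψ', h1, h2, v, h3, h4.trans ?_⟩
    rw [← hgen z]
    exact (Category.assoc _ _ _).symm
  choose ψ' hψ' hψ'φ v hv hvΨ using hlift
  -- `v z` is the point corresponding under `e` to the generic point of `Ψ`, for every `z`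
  have hvv : ∀ z z', v z = v z' := fun z z' ↦ by
    rw [← cancel_mono (e.iso.hom ≫ e.target.ι), hvΨ, hvΨ]
  obtain ⟨z₀⟩ := ‹Nonempty Z›
  obtain ⟨Φ, hΦ, hΦv⟩ := exists_extension
    (fun c ↦ ValuationRing.of_isPrincipal_maximalIdeal (hprin c)) sC sX' (v z₀ ≫ e.source.ι) (by
      rw [hv, Category.assoc, hψ', hk, ← Category.assoc, hgen])
  refine ⟨Φ, hΦ, eq_of_fromSpecStalk _ _ fun z ↦ ?_⟩
  have hΦψ : C.fromSpecStalk (i z) ≫ Φ = ψ' z := by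
    have : IsDominant (gen z) :=
      isDominant_SpecMap_algebraMap (C.presheaf.stalk (i z)) C.functionField
    refine ext_of_isDominant_of_isSeparated sX' ?_ (gen z) ?_
    · rw [Category.assoc, hΦ, hψ', hk]
    · rw [← Category.assoc, hgen, hΦv, hvv z₀ z, hv]
  rw [← hψ'φ, ← hΦψ, Scheme.SpecMap_stalkMap_fromSpecStalk_assoc]
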